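/- **Theorem (Statistical convergence).** There is an absolute constant $C_1>0$ and, for every integer $K\ge 1$, a constant $C_2>0$ depending only on $K$, such that the following holds for all $d_1,\dots,d_K\ge 1$, all $R\ge 1$ and all $\alpha>0$. Let $f\colon\mathbb R\to[0,1]$ be strictly increasing and strictly log-concave, twice differentiable on $\mathbb R\setminus\{0\}$, symmetric in the sense that $f(-\theta)=1-f(\theta)$ for all $\theta$ (so that $f'$ is even), with $f'$ unimodal with mode $0$. Put $$L_\alpha=\sup_{|\theta|\le\alpha}\frac{f'(\theta)}{f(\theta)(1-f(\theta))},\qquad \gamma_\alpha=\inf_{|\theta|\le\alpha,\ \theta\ne0}\Big\{\frac{f'(\theta)^2}{f(\theta)^2}-\frac{f''(\theta)}{f(\theta)}\Big\}.$$ Let $\mathcal D$ be a compact set of tensors $\Theta\in\mathbb R^{d_1\times\cdots\times d_K}$ of CP rank exactly $R$ with $\max_{i_1,\dots,i_K}|\theta_{i_1,\dots,i_K}|\le\alpha$, and let $\Theta_{\mathrm{true}}\in\mathcal D$. Let $\mathcal Y\in\{0,1\}^{d_1\times\cdots\times d_K}$ be a random tensor with independent entries and $\mathbb P(y_{i_1,\dots,i_K}=1)=f(\theta_{\mathrm{true},i_1,\dots,i_K})$,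 and let $$\mathcal L_{\mathcal Y}(\Theta)=\sum_{i_1,\dots,i_K}\Big[\mathbf 1_{\{y_{i_1,\dots,i_K}=1\}}\log f(\theta_{i_1,\dots,i_K})+\mathbf 1_{\{y_{i_1,\dots,i_K}=0\}}\log\{1-f(\theta_{i_1,\dots,i_K})\}\Big].$$ Then the constrained maximum likelihood estimate $\hat\Theta_{\mathrm{MLE}}\in\arg\max_{\Theta\in\mathcal D}\mathcal L_{\mathcal Y}(\Theta)$ exists, and with probability at least $1-\exp(-C_1\log K\sum_k d_k)$ every such $\hat\Theta=\hat\Theta_{\mathrm{MLE}}$ satisfies $$\frac{1}{\sqrt{\prod_k d_k}}\,\|\hat\Theta-\Theta_{\mathrm{true}}\|_F\le\min\left(2\alpha,\ \frac{C_2L_\alpha}{\gamma_\alpha}\sqrt{\frac{R^{K-1}\sum_k d_k}{\prod_k d_k}}\right),$$ where the quotient is read as $+\infty$ if $\gamma_\alpha=0$. With probability at least $1-\exp(-C_1\log K\sum_k d_k)$, the same bound holds simultaneously for all $\hat\Theta\in\mathcal D$ with $\mathcal L_{\mathcal Y}(\hat\Theta)\ge\mathcal L_{\mathcal Y}(\Theta_{\mathrm{true}})$.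 -/

import Mathlib

open MeasureTheory ProbabilityTheory
open scoped ENNReal

namespace BinaryTensor

/-- Multi-indices `(i₁, …, i_K)` of order-`K` tensors of dimension `(d₁, …, d_K)`. -/
abbrev Index {K : ℕ} (d : Fin K → ℕ) : Type := (k : Fin K) → Fin (d k)

/-- Real tensors of dimension `(d₁, …, d_K)`. -/
abbrev Tensor {K : ℕ} (d : Fin K → ℕ) : Type := Index d → ℝ

/-- Binary tensors of dimension `(d₁, …, d_K)`, with entries in `{0, 1}`. -/
abbrev BinTensor {K : ℕ} (d : Fin K → ℕ) : Type := Index d → Fin 2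

noncomputable section

variable {K : ℕ} {d : Fin K → ℕ}

/-- The outer product of the vectors `a k ∈ ℝ^(d k)`. -/
def outer (a : (k : Fin K) → Fin (d k) → ℝ) : Tensor d :=
  fun i => ∏ k, a k (i k)

/-- The (CP) rank: the least number of outer products that sum to `Θ`. -/
def cpRank (Θ : Tensor d) : ℕ :=
  sInf {R : ℕ | ∃ a : Fin R → (k : Fin K) → Fin (d k) → ℝ, Θ = ∑ r, outer (a r)}

/-- The Frobenius norm. -/
def frobNorm (Θ : Tensor d) : ℝ := √(∑ i, Θ i ^ 2)

/-- The maximum norm. -/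
def maxNorm (Θ : Tensor d) : ℝ := ⨆ i, |Θ i|

/-- The set of tensors of rank exactly `R` and maximum norm at most `α`. -/
def paramSet (d : Fin K → ℕ) (R : ℕ) (α : ℝ) : Set (Tensor d) :=
  {Θ | cpRank Θ = R ∧ maxNorm Θ ≤ α}

/-- The assumptions on the link function. Values in `[0, 1]` and strict monotonicity force
`0 < f < 1`. The field `symm` makes `f'` an even function. -/
structure IsLink (f : ℝ → ℝ) : Prop where
  mem_Icc : ∀ θ, f θ ∈ Set.Icc (0 : ℝ) 1
  strictMono : StrictMono f
  differentiableAt : ∀ θ, θ ≠ 0 → DifferentiableAt ℝ f θ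
  differentiableAt_deriv : ∀ θ, θ ≠ 0 → DifferentiableAt ℝ (deriv f) θ
  strictLogConcave : StrictConcaveOn ℝ Set.univ (fun θ => Real.log (f θ))
  symm : ∀ θ, f (-θ) = 1 - f θ
  unimodal_left : MonotoneOn (deriv f) (Set.Iic 0)
  unimodal_right : AntitoneOn (deriv f) (Set.Ici 0)

/-- `L_α = sup_{|θ| ≤ α} f'(θ) / (f(θ) (1 - f(θ)))`. -/
def steepness (f : ℝ → ℝ) (α : ℝ) : ℝ :=
  sSup ((fun θ => deriv f θ / (f θ * (1 - f θ))) '' {θ : ℝ | |θ| ≤ α})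

/-- `γ_α = inf_{|θ| ≤ α} (f'(θ)² / f(θ)² - f''(θ) / f(θ))`, over the points `θ ≠ 0`, at which
`f` is assumed to be twice differentiable. -/
def convexity (f : ℝ → ℝ) (α : ℝ) : ℝ :=
  sInf ((fun θ => deriv f θ ^ 2 / f θ ^ 2 - deriv (deriv f) θ / f θ) ''
    {θ : ℝ | |θ| ≤ α ∧ θ ≠ 0})

/-- The log-likelihood of `Θ` given the binary tensor `y`. -/
def logLik (f : ℝ → ℝ) (y : BinTensor d) (Θ : Tensor d) : ℝ :=
  ∑ i, ((if y i = 1 then Real.log (f (Θ i)) else 0) +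
    (if y i = 0 then Real.log (1 - f (Θ i)) else 0))

/-- `Θhat` is a maximum likelihood estimate over the search space `D`. -/
def IsMLE (f : ℝ → ℝ) (D : Set (Tensor d)) (y : BinTensor d) (Θhat : Tensor d) : Prop :=
  Θhat ∈ D ∧ ∀ Θ ∈ D, logLik f y Θ ≤ logLik f y Θhat

/-- `Θhat` lies in `D` and its likelihood is at least that of `Θtrue`. -/
def InLevelSet (f : ℝ → ℝ) (D : Set (Tensor d)) (Θtrue : Tensor d) (y : BinTensor d)
    (Θhat : Tensor d) : Prop :=
  Θhat ∈ D ∧ logLik f y Θtrue ≤ logLik f y Θhat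

/-- The random binary tensor `Y` has independent Bernoulli entries with success probabilities
`f (Θ i)`. -/
structure IsBernoulliModel {Ω : Type*} [MeasurableSpace Ω] (f : ℝ → ℝ) (Θ : Tensor d)
    (μ : Measure Ω) (Y : Ω → BinTensor d) : Prop where
  measurable : ∀ i, Measurable (fun ω => Y ω i)
  indep : iIndepFun (fun i ω => Y ω i) μ
  prob : ∀ i, μ {ω | Y ω i = 1} = ENNReal.ofReal (f (Θ i))

/-- The normalized Frobenius loss. -/
def loss (Θhat Θtrue : Tensor d) : ℝ :=
  1 / √(∏ k, (d k : ℝ)) * frobNorm (Θhat - Θtrue)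

/-- `min (2α, C₂ L_α / γ_α · √(R^(K-1) ∑ d_k / ∏ d_k))`. It is valued in `[0, ∞]`, where the
quotient is `∞` if `γ_α = 0`. -/
def errorBound (d : Fin K → ℕ) (f : ℝ → ℝ) (R : ℕ) (α C₂ : ℝ) : ℝ≥0∞ :=
  min (ENNReal.ofReal (2 * α))
    (ENNReal.ofReal (C₂ * steepness f α) / ENNReal.ofReal (convexity f α) *
      ENNReal.ofReal √((R : ℝ) ^ (K - 1) * (∑ k, (d k : ℝ)) / ∏ k, (d k : ℝ)))

end

end BinaryTensor

/-!
Since `-(log f)''` is at least `γ_α` on `|θ| ≤ α`, the log-likelihood is `γ_α`-strongly concave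
there, so an estimate `Θ'` at least as likely as the truth `Θ` satisfies
`γ_α / 2 * ‖Δ‖² ≤ ⟪S, Δ⟫` with `Δ = Θ' - Θ` and `S` the score tensor at `Θ`. It remains to bound
`⟪S, Δ⟫` by a multiple of `‖Δ‖`.

If `M` bounds the spectral norm of `S` and `Δ` is a combination of `r` outer products, then
`⟪S, Δ⟫ ≤ M * r ^ ((K - 1) / 2) * ‖Δ‖`: unfold along the first mode, expand `Δ` in an orthonormal
basis of the span (of dimension at most `r`) of the columns, recurse on the slices, and apply
Cauchy–Schwarz. Here `r = 2 * R`. The entries of `S` are independent, centered and sub-Gaussian with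
parameter proportional to `L_α`, so a union bound over a product of finite norming sets, of at most
`5 ^ d k` vectors each, controls its spectral norm.
-/

namespace BinaryTensor

open Metric WithLp Matrix
open scoped RealInnerProductSpace

section Norming

variable {E : Type*} [NormedAddCommGroup E] [InnerProductSpace ℝ E]

/-- A norming set: every upper bound for the inner products of `v` with the elements of the set is
an upper bound for `‖v‖`. A finite norming set reduces a bound for a norm to a union bound; its
elements need not be unit vectors. -/
def IsNorming (s : Set E) : Prop :=
  ∀ (v : E) (m : ℝ), (∀ c ∈ s, ⟪c, v⟫ ≤ m) → ‖v‖ ≤ m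

lemma isNorming_of_isCover {s : Set E} (hs : IsCover 1 (closedBall 0 2) s) : IsNorming s := by
  intro v m hm
  have hmem : (2 / ‖v‖) • v ∈ closedBall (0 : E) 2 := by
    rw [mem_closedBall_zero_iff, norm_smul, norm_div, norm_norm, Real.norm_ofNat,
      div_mul_eq_mul_div, mul_div_assoc]
    exact mul_le_of_le_one_right zero_le_two (div_self_le_one _)
  obtain ⟨c, hc, hdist⟩ := Set.mem_iUnion₂.1 (isCover_iff_subset_iUnion_closedBall.1 hs hmem)
  have hinner : ⟪(2 / ‖v‖) • v, v⟫ = 2 * ‖v‖ := by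
    rw [real_inner_smul_left, real_inner_self_eq_norm_sq, sq, ← mul_assoc]
    rcases eq_or_ne ‖v‖ 0 with h0 | h0
    · simp [h0]
    · rw [div_mul_cancel₀ _ h0]
  have hsub : ⟪(2 / ‖v‖) • v - c, v⟫ ≤ ‖v‖ :=
    (real_inner_le_norm _ _).trans
      (mul_le_of_le_one_left (norm_nonneg v) (by simpa [dist_eq_norm] using hdist))
  rw [inner_sub_left, hinner] at hsub
  linarith [hm c hc]

lemma packingNumber_one_closedBall_two_le (E : Type*) [NormedAddCommGroup E] [NormedSpace ℝ E]
    [FiniteDimensional ℝ E] :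
    packingNumber 1 (closedBall (0 : E) 2) ≤ 5 ^ Module.finrank ℝ E := by
  refine iSup_le fun C => iSup₂_le fun hC hsep => ?_
  by_contra! hlt
  obtain ⟨F, hFC, hF⟩ := Set.exists_subset_encard_eq (Order.add_one_le_of_lt hlt)
  have hfin : F.Finite := Set.finite_of_encard_eq_coe (k := 5 ^ Module.finrank ℝ E + 1) (by simpa)
  have hcard := Besicovitch.card_le_of_separated hfin.toFinset
    (fun c hc => mem_closedBall_zero_iff.1 (hC (hFC (hfin.mem_toFinset.1 hc))))
    (fun c hc e he hne => by
      have h : ((1 : NNReal) : ℝ≥0∞) < edist c e :=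
        hsep (hFC (hfin.mem_toFinset.1 hc)) (hFC (hfin.mem_toFinset.1 he)) hne
      rw [edist_nndist, ENNReal.coe_lt_coe] at h
      rw [← dist_eq_norm]
      exact_mod_cast h.le)
  rw [hfin.encard_eq_coe_toFinset_card] at hF
  have : hfin.toFinset.card = 5 ^ Module.finrank ℝ E + 1 := by exact_mod_cast hF
  omega

lemma exists_isNorming (E : Type*) [NormedAddCommGroup E] [InnerProductSpace ℝ E]
    [FiniteDimensional ℝ E] :
    ∃ s : Finset E, s.card ≤ 5 ^ Module.finrank ℝ E ∧ (∀ c ∈ s, ‖c‖ ≤ 2) ∧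
      IsNorming (s : Set E) := by
  have hle := (coveringNumber_le_packingNumber 1 (closedBall (0 : E) 2)).trans
    (packingNumber_one_closedBall_two_le E)
  obtain ⟨C, hCsub, hCfin, hCcov, hCcard⟩ := exists_set_encard_eq_coveringNumber
    (ne_top_of_le_ne_top (by exact_mod_cast ENat.natCast_ne_top (5 ^ Module.finrank ℝ E)) hle)
  rw [← hCcard, hCfin.encard_eq_coe_toFinset_card] at hle
  refine ⟨hCfin.toFinset, by exact_mod_cast hle, fun c hc => ?_, ?_⟩
  · exact mem_closedBall_zero_iff.1 (hCsub (hCfin.mem_toFinset.1 hc))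
  · rw [hCfin.coe_toFinset]
    exact isNorming_of_isCover hCcov

lemma sum_inner_mul_inner_of_mem {ι : Type*} [Fintype ι] {W : Submodule ℝ E}
    (b : OrthonormalBasis ι ℝ W) (x : E) {y : E} (hy : y ∈ W) :
    ∑ p, ⟪x, b p⟫ * ⟪(b p : E), y⟫ = ⟪x, y⟫ := by
  have hsum := congrArg (fun z : W => ⟪x, z⟫) (b.sum_repr' ⟨y, hy⟩)
  simp only [Submodule.coe_sum, Submodule.coe_smul, Submodule.coe_inner, inner_sum,
    real_inner_smul_right] at hsum
  simpa only [mul_comm] using hsum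

end Norming

section Unfolding

variable {K : ℕ} {d : Fin (K + 1) → ℕ}

/-- The unfolding of a tensor along its first mode, as a matrix whose columns are the mode-one
fibres. The remaining modes are kept as a multi-index. -/
def unfolding : Tensor d →ₗ[ℝ] Matrix (Fin (d 0)) (Index fun k => d k.succ) ℝ where
  toFun S := .of fun j i => S (Fin.cons j i)
  map_add' _ _ := rfl
  map_smul' _ _ := rfl

lemma unfolding_apply (S : Tensor d) (j : Fin (d 0)) (i : Index fun k => d k.succ) :
    unfolding S j i = S (Fin.cons j i) := rfl

lemma unfolding_outer (u : (k : Fin (K + 1)) → Fin (d k) → ℝ) :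
    unfolding (outer u) = vecMulVec (u 0) (outer fun k => u k.succ) := by
  ext j i
  simp [unfolding_apply, outer, vecMulVec_apply, Fin.prod_univ_succ]

lemma dotProduct_eq_sum_unfolding (S T : Tensor d) :
    S ⬝ᵥ T = ∑ i, (unfolding S).col i ⬝ᵥ (unfolding T).col i := by
  rw [dotProduct, ← (Fin.consEquiv fun k => Fin (d k)).sum_comp, Fintype.sum_prod_type_right]
  rfl

lemma dotProduct_outer (S : Tensor d) (u : (k : Fin (K + 1)) → Fin (d k) → ℝ) :
    S ⬝ᵥ outer u = (u 0 ᵥ* unfolding S) ⬝ᵥ outer fun k => u k.succ := by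
  simp only [dotProduct_eq_sum_unfolding, unfolding_outer]
  refine Finset.sum_congr rfl fun i _ => ?_
  simp only [dotProduct, col_apply, vecMulVec_apply, vecMul, Finset.sum_mul]
  exact Finset.sum_congr rfl fun j _ => by ring

variable {ι : Type*} {a : ι → (k : Fin (K + 1)) → Fin (d k) → ℝ} {T : Tensor d}

lemma toLp_col_unfolding_mem_span (hT : T ∈ Submodule.span ℝ (Set.range fun r => outer (a r)))
    (i : Index fun k => d k.succ) :
    toLp 2 ((unfolding T).col i) ∈ Submodule.span ℝ (Set.range fun r => toLp 2 (a r 0)) := by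
  induction hT using Submodule.span_induction with
  | mem T hT =>
    obtain ⟨r, rfl⟩ := hT
    have hcol : (unfolding (outer (a r))).col i = outer (fun k => a r k.succ) i • a r 0 := by
      ext j
      simp [unfolding_outer, vecMulVec_apply, mul_comm]
    rw [hcol, toLp_smul]
    exact Submodule.smul_mem _ _ (Submodule.subset_span ⟨r, rfl⟩)
  | zero => exact map_zero (unfolding (d := d)) ▸ Submodule.zero_mem _
  | add S T _ _ hS hT => exact map_add unfolding S T ▸ Submodule.add_mem _ hS hT
  | smul c T _ hT => exact map_smul unfolding c T ▸ Submodule.smul_mem _ c hT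

lemma vecMul_unfolding_mem_span (hT : T ∈ Submodule.span ℝ (Set.range fun r => outer (a r)))
    (v : Fin (d 0) → ℝ) :
    v ᵥ* unfolding T ∈ Submodule.span ℝ (Set.range fun r => outer fun k => a r k.succ) := by
  induction hT using Submodule.span_induction with
  | mem T hT =>
    obtain ⟨r, rfl⟩ := hT
    rw [unfolding_outer, vecMul_vecMulVec]
    exact Submodule.smul_mem _ _ (Submodule.subset_span ⟨r, rfl⟩)
  | zero => simp
  | add S T _ _ hS hT =>
    rw [map_add, vecMul_add]
    exact Submodule.add_mem _ hS hT
  | smul c T _ hT =>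
    rw [map_smul, vecMul_smul]
    exact Submodule.smul_mem _ c hT

lemma dotProduct_eq_sum_vecMul_unfolding {κ : Type*} [Fintype κ]
    {W : Submodule ℝ (EuclideanSpace ℝ (Fin (d 0)))} (b : OrthonormalBasis κ ℝ W)
    (hT : ∀ i, toLp 2 ((unfolding T).col i) ∈ W) (S : Tensor d) :
    S ⬝ᵥ T = ∑ p, (ofLp (b p : EuclideanSpace ℝ (Fin (d 0))) ᵥ* unfolding S) ⬝ᵥ
      (ofLp (b p : EuclideanSpace ℝ (Fin (d 0))) ᵥ* unfolding T) := by
  have hcol (i) := sum_inner_mul_inner_of_mem b (toLp 2 ((unfolding S).col i)) (hT i)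
  simp only [EuclideanSpace.inner_eq_star_dotProduct, star_trivial] at hcol
  simp only [dotProduct_eq_sum_unfolding]
  rw [Finset.sum_congr rfl fun i _ => (dotProduct_comm _ _).trans (hcol i).symm, Finset.sum_comm]
  refine Finset.sum_congr rfl fun p _ => Finset.sum_congr rfl fun i _ => ?_
  rw [dotProduct_comm ((unfolding T).col i)]
  rfl

end Unfolding

section SpectralBound

variable {K : ℕ}

/-- The spectral norm of the tensor `S` is at most `M`: on rank-one tensors, the linear form given
by `S` is bounded by `M` times the product of the Euclidean norms of the factors. -/
def IsSpectralBound {d : Fin K → ℕ} (S : Tensor d) (M : ℝ) : Prop :=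
  ∀ u : (k : Fin K) → EuclideanSpace ℝ (Fin (d k)),
    S ⬝ᵥ outer (fun k => ofLp (u k)) ≤ M * ∏ k, ‖u k‖

lemma isSpectralBound_of_isNorming {d : Fin K → ℕ} {S : Tensor d} {M : ℝ}
    {s : (k : Fin K) → Set (EuclideanSpace ℝ (Fin (d k)))} (hs : ∀ k, IsNorming (s k))
    (h : ∀ v : (k : Fin K) → EuclideanSpace ℝ (Fin (d k)), (∀ k, v k ∈ s k) →
      S ⬝ᵥ outer (fun k => ofLp (v k)) ≤ M) :
    IsSpectralBound S M := by
  intro u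
  induction K generalizing M with
  | zero => simpa using h u fun k => k.elim0
  | succ K ih =>
    rw [dotProduct_outer, Fin.prod_univ_succ, ← mul_assoc]
    refine ih (fun k => hs k.succ) (fun v hv => ?_) fun k => u k.succ
    have hw (c : EuclideanSpace ℝ (Fin (d 0))) :
        ⟪c, toLp 2 (unfolding S *ᵥ outer fun k => ofLp (v k))⟫ =
          (ofLp c ᵥ* unfolding S) ⬝ᵥ outer fun k => ofLp (v k) := by
      rw [EuclideanSpace.inner_eq_star_dotProduct, star_trivial, dotProduct_comm,
        dotProduct_mulVec]
    have hnorm : ‖toLp 2 (unfolding S *ᵥ outer fun k => ofLp (v k))‖ ≤ M := by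
      refine hs 0 _ _ fun c hc => ?_
      rw [hw]
      simpa [dotProduct_outer] using h (Fin.cons c v) (Fin.cases hc hv)
    rw [← hw, mul_comm M]
    exact (real_inner_le_norm _ _).trans (mul_le_mul_of_nonneg_left hnorm (norm_nonneg _))

lemma IsSpectralBound.vecMul_unfolding {d : Fin (K + 1) → ℕ} {S : Tensor d} {M : ℝ}
    (hS : IsSpectralBound S M) (v : EuclideanSpace ℝ (Fin (d 0))) :
    IsSpectralBound (ofLp v ᵥ* unfolding S) (M * ‖v‖) := by
  intro u
  simpa [dotProduct_outer, Fin.prod_univ_succ, mul_assoc] using hS (Fin.cons v u)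

lemma frobNorm_nonneg {d : Fin K → ℕ} (T : Tensor d) : 0 ≤ frobNorm T := Real.sqrt_nonneg _

lemma frobNorm_eq_norm {d : Fin K → ℕ} (T : Tensor d) : frobNorm T = ‖toLp 2 T‖ := by
  simp [frobNorm, EuclideanSpace.norm_eq]

lemma frobNorm_sq {d : Fin K → ℕ} (T : Tensor d) : frobNorm T ^ 2 = T ⬝ᵥ T := by
  rw [frobNorm_eq_norm, EuclideanSpace.real_norm_sq_eq]
  simp [dotProduct, sq]

lemma frobNorm_outer {d : Fin K → ℕ} (u : (k : Fin K) → Fin (d k) → ℝ) :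
    frobNorm (outer u) = ∏ k, ‖toLp 2 (u k)‖ := by
  have hsq : ∑ i, outer u i ^ 2 = ∏ k, ∑ j, u k j ^ 2 := by
    rw [Finset.prod_univ_sum, Fintype.piFinset_univ]
    exact Finset.sum_congr rfl fun i _ => (Finset.prod_pow _ _ _).symm
  rw [frobNorm, hsq, Real.sqrt_prod _ fun k _ => Finset.sum_nonneg fun j _ => sq_nonneg _]
  simp [EuclideanSpace.norm_eq]

lemma frobNorm_outer_le_pow {d : Fin K → ℕ} {u : (k : Fin K) → Fin (d k) → ℝ} {m : ℝ}
    (hu : ∀ k, ‖toLp 2 (u k)‖ ≤ m) : frobNorm (outer u) ≤ m ^ K := by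
  rw [frobNorm_outer]
  exact (Finset.prod_le_prod (fun k _ => norm_nonneg _) fun k _ => hu k).trans_eq (by simp)

lemma exists_eq_outer_of_order_one {d : Fin 1 → ℕ} (T : Tensor d) : ∃ u, T = outer u := by
  refine ⟨Fin.cons (fun j => T (Fin.cons j finZeroElim)) finZeroElim, funext fun i => ?_⟩
  have hi : i = Fin.cons (i 0) finZeroElim := funext fun k => by rw [Subsingleton.elim k 0]; rfl
  rw [hi]
  simp [outer]

lemma sum_frobNorm_vecMul_unfolding_le {d : Fin (K + 1) → ℕ} {T : Tensor d} {κ : Type*}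
    [Fintype κ] {W : Submodule ℝ (EuclideanSpace ℝ (Fin (d 0)))} (b : OrthonormalBasis κ ℝ W)
    (hT : ∀ i, toLp 2 ((unfolding T).col i) ∈ W) :
    ∑ p, frobNorm (ofLp (b p : EuclideanSpace ℝ (Fin (d 0))) ᵥ* unfolding T) ≤
      √(Fintype.card κ) * frobNorm T := by
  have hcs := Real.sum_mul_le_sqrt_mul_sqrt Finset.univ (fun _ : κ => (1 : ℝ))
    fun p => frobNorm (ofLp (b p : EuclideanSpace ℝ (Fin (d 0))) ᵥ* unfolding T)
  have hsq : ∑ p, frobNorm (ofLp (b p : EuclideanSpace ℝ (Fin (d 0))) ᵥ* unfolding T) ^ 2 =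
      frobNorm T ^ 2 := by
    simp only [frobNorm_sq, dotProduct_eq_sum_vecMul_unfolding b hT T]
  simpa only [one_mul, one_pow, Finset.sum_const, Finset.card_univ, nsmul_eq_mul, mul_one, hsq,
    Real.sqrt_sq (frobNorm_nonneg T)] using hcs

theorem IsSpectralBound.dotProduct_le {d : Fin (K + 1) → ℕ} {S T : Tensor d} {M : ℝ}
    (hS : IsSpectralBound S M) (hM : 0 ≤ M) {ι : Type*} [Fintype ι]
    {a : ι → (k : Fin (K + 1)) → Fin (d k) → ℝ}
    (hT : T ∈ Submodule.span ℝ (Set.range fun r => outer (a r))) :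
    S ⬝ᵥ T ≤ M * √((Fintype.card ι : ℝ) ^ K) * frobNorm T := by
  induction K generalizing M with
  | zero =>
    obtain ⟨u, rfl⟩ := exists_eq_outer_of_order_one T
    simpa [frobNorm_outer] using hS fun k => toLp 2 (u k)
  | succ K ih =>
    let W := Submodule.span ℝ (Set.range fun r => toLp 2 (a r 0))
    let b := stdOrthonormalBasis ℝ W
    let e (p) : EuclideanSpace ℝ (Fin (d 0)) := b p
    have he (p) : ‖e p‖ = 1 := b.orthonormal.1 p
    have hcol := toLp_col_unfolding_mem_span hT
    have hrank : Module.finrank ℝ W ≤ Fintype.card ι := finrank_range_le_card _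
    calc S ⬝ᵥ T = ∑ p, (ofLp (e p) ᵥ* unfolding S) ⬝ᵥ (ofLp (e p) ᵥ* unfolding T) :=
          dotProduct_eq_sum_vecMul_unfolding b hcol S
      _ ≤ ∑ p, M * √((Fintype.card ι : ℝ) ^ K) * frobNorm (ofLp (e p) ᵥ* unfolding T) := by
          refine Finset.sum_le_sum fun p _ => ih ?_ hM (vecMul_unfolding_mem_span hT _)
          simpa only [he, mul_one] using hS.vecMul_unfolding (e p)
      _ ≤ M * √((Fintype.card ι : ℝ) ^ K) * (√(Fintype.card ι) * frobNorm T) := by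
          rw [← Finset.mul_sum]
          gcongr
          refine (sum_frobNorm_vecMul_unfolding_le b hcol).trans ?_
          rw [Fintype.card_fin]
          gcongr
          exact frobNorm_nonneg T
      _ = M * √((Fintype.card ι : ℝ) ^ (K + 1)) * frobNorm T := by
          rw [pow_succ, Real.sqrt_mul (by positivity)]
          ring

end SpectralBound

section StrongConcavity

variable {g g' g'' : ℝ → ℝ} {l c r m : ℝ}

lemma concaveOn_Icc_of_concaveOn_Icc_of_concaveOn_Icc (hc : c ∈ Set.Icc l r)
    (hl : ConcaveOn ℝ (Set.Icc l c) g) (hr : ConcaveOn ℝ (Set.Icc c r) g)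
    (hg : ∀ x ∈ Set.Icc l r, DifferentiableAt ℝ g x) : ConcaveOn ℝ (Set.Icc l r) g := by
  have hanti : AntitoneOn (deriv g) (Set.Icc l r) := by
    rw [← Set.Icc_union_Icc_eq_Icc hc.1 hc.2]
    exact (hl.antitoneOn_deriv fun x hx => hg x ⟨hx.1, hx.2.trans hc.2⟩).union_right
      (hr.antitoneOn_deriv fun x hx => hg x ⟨hc.1.trans hx.1, hx.2⟩)
      (isGreatest_Icc hc.1) (isLeast_Icc hc.2)
  exact (hanti.mono interior_subset).concaveOn_of_deriv (convex_Icc l r)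
    (fun x hx => (hg x hx).continuousAt.continuousWithinAt)
    fun x hx => (hg x (interior_subset hx)).differentiableWithinAt

lemma strongConcaveOn_Icc_of_hasDerivAt2_le_of_ne (hc : c ∈ Set.Icc l r)
    (hg : ∀ x ∈ Set.Icc l r, HasDerivAt g (g' x) x)
    (hg' : ∀ x ∈ Set.Icc l r, x ≠ c → HasDerivAt g' (g'' x) x)
    (hle : ∀ x ∈ Set.Icc l r, x ≠ c → g'' x ≤ -m) : StrongConcaveOn (Set.Icc l r) m g := by
  simp only [strongConcaveOn_iff_convex, Real.norm_eq_abs, sq_abs]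
  have hderiv (x) (hx : x ∈ Set.Icc l r) :
      HasDerivAt (fun x => g x + m / 2 * x ^ 2) (g' x + m * x) x :=
    ((hg x hx).add ((hasDerivAt_pow 2 x).const_mul (m / 2))).congr_deriv (by norm_num; ring)
  have hderiv2 (x) (hx : x ∈ Set.Icc l r) (hxc : x ≠ c) :
      HasDerivAt (fun x => g' x + m * x) (g'' x + m) x :=
    ((hg' x hx hxc).add ((hasDerivAt_id x).const_mul m)).congr_deriv (by ring)
  have hconc (p q : ℝ) (hpq : Set.Icc p q ⊆ Set.Icc l r) (hne : ∀ x ∈ Set.Ioo p q, x ≠ c) :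
      ConcaveOn ℝ (Set.Icc p q) fun x => g x + m / 2 * x ^ 2 := by
    have hmem {x} (hx : x ∈ interior (Set.Icc p q)) : x ∈ Set.Icc l r ∧ x ≠ c :=
      ⟨hpq (interior_subset hx), hne x (interior_Icc (a := p) ▸ hx)⟩
    exact concaveOn_of_hasDerivWithinAt2_nonpos (convex_Icc p q)
      (fun x hx => (hderiv x (hpq hx)).continuousAt.continuousWithinAt)
      (fun x hx => (hderiv x (hmem hx).1).hasDerivWithinAt)
      (fun x hx => (hderiv2 x (hmem hx).1 (hmem hx).2).hasDerivWithinAt)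
      fun x hx => by linarith [hle x (hmem hx).1 (hmem hx).2]
  exact concaveOn_Icc_of_concaveOn_Icc_of_concaveOn_Icc hc
    (hconc l c (Set.Icc_subset_Icc_right hc.2) fun x hx => hx.2.ne)
    (hconc c r (Set.Icc_subset_Icc_left hc.1) fun x hx => hx.1.ne')
    fun x hx => (hderiv x hx).differentiableAt

lemma concaveOn_le_tangent {s : Set ℝ} {a b a' : ℝ} (hg : ConcaveOn ℝ s g) (ha : a ∈ s)
    (hb : b ∈ s) (hd : HasDerivAt g a' a) : g b ≤ g a + a' * (b - a) := by
  rcases lt_trichotomy a b with hab | rfl | hab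
  · have h := hg.slope_le_of_hasDerivAt ha hb hab hd
    rw [slope_def_field, div_le_iff₀ (sub_pos.2 hab)] at h
    linarith
  · simp
  · have h := hg.le_slope_of_hasDerivAt hb ha hab hd
    rw [slope_def_field, le_div_iff₀ (sub_pos.2 hab)] at h
    linarith

lemma strongConcaveOn_le_quadratic {s : Set ℝ} {a b a' : ℝ} (hg : StrongConcaveOn s m g)
    (ha : a ∈ s) (hb : b ∈ s) (hd : HasDerivAt g a' a) :
    g b ≤ g a + a' * (b - a) - m / 2 * (b - a) ^ 2 := by
  simp only [strongConcaveOn_iff_convex, Real.norm_eq_abs, sq_abs] at hg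
  have hderiv : HasDerivAt (fun x => g x + m / 2 * x ^ 2) (a' + m * a) a :=
    (hd.add ((hasDerivAt_pow 2 a).const_mul (m / 2))).congr_deriv (by norm_num; ring)
  linarith [concaveOn_le_tangent hg ha hb hderiv]

end StrongConcavity

/-- The properties of the link function of a binary tensor model which the statistical convergence
rate rests on: those of `IsLink` except log-concavity, which is measured by `convexity f α`. -/
structure IsUnimodalLink (f : ℝ → ℝ) : Prop where
  mem_Icc : ∀ θ, f θ ∈ Set.Icc (0 : ℝ) 1
  strictMono : StrictMono f
  differentiableAt : ∀ θ, θ ≠ 0 → DifferentiableAt ℝ f θ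
  differentiableAt_deriv : ∀ θ, θ ≠ 0 → DifferentiableAt ℝ (deriv f) θ
  symm : ∀ θ, f (-θ) = 1 - f θ
  unimodal_left : MonotoneOn (deriv f) (Set.Iic 0)
  unimodal_right : AntitoneOn (deriv f) (Set.Ici 0)

lemma IsLink.isUnimodalLink {f : ℝ → ℝ} (hf : IsLink f) : IsUnimodalLink f :=
  { hf with }

namespace IsUnimodalLink

variable {f : ℝ → ℝ} {α : ℝ}

lemma pos (hf : IsUnimodalLink f) (θ : ℝ) : 0 < f θ :=
  (hf.mem_Icc (θ - 1)).1.trans_lt (hf.strictMono (sub_one_lt θ))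

lemma lt_one (hf : IsUnimodalLink f) (θ : ℝ) : f θ < 1 :=
  (hf.strictMono (lt_add_one θ)).trans_le (hf.mem_Icc (θ + 1)).2

lemma deriv_nonneg (hf : IsUnimodalLink f) (θ : ℝ) : 0 ≤ deriv f θ :=
  hf.strictMono.monotone.deriv_nonneg

lemma deriv_neg (hf : IsUnimodalLink f) (θ : ℝ) : deriv f (-θ) = deriv f θ := by
  have h : deriv (fun x => f (-x)) θ = deriv (fun x => 1 - f x) θ := by simp only [hf.symm]
  rw [deriv_comp_neg, deriv_const_sub] at h
  linarith

lemma deriv_le_deriv_zero (hf : IsUnimodalLink f) (θ : ℝ) : deriv f θ ≤ deriv f 0 := by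
  rcases le_total θ 0 with h | h
  · exact hf.unimodal_left h Set.self_mem_Iic h
  · exact hf.unimodal_right Set.self_mem_Ici h h

lemma deriv_zero_pos (hf : IsUnimodalLink f) : 0 < deriv f 0 := by
  have hdiff (x) (hx : x ∈ Set.Icc (1 : ℝ) 2) : DifferentiableAt ℝ f x :=
    hf.differentiableAt x (by linarith [hx.1])
  obtain ⟨c, -, hc⟩ := exists_deriv_eq_slope f one_lt_two
    (fun x hx => (hdiff x hx).continuousAt.continuousWithinAt)
    fun x hx => (hdiff x (Set.Ioo_subset_Icc_self hx)).differentiableWithinAt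
  have hslope : 0 < (f 2 - f 1) / (2 - 1) :=
    div_pos (sub_pos.2 (hf.strictMono one_lt_two)) (by norm_num)
  exact (hc ▸ hslope).trans_le (hf.deriv_le_deriv_zero c)

lemma differentiable (hf : IsUnimodalLink f) : Differentiable ℝ f := by
  intro θ
  rcases eq_or_ne θ 0 with rfl | h
  · exact differentiableAt_of_deriv_ne_zero hf.deriv_zero_pos.ne'
  · exact hf.differentiableAt θ h

lemma bddAbove_steepness (hf : IsUnimodalLink f) (α : ℝ) :
    BddAbove ((fun θ => deriv f θ / (f θ * (1 - f θ))) '' {θ : ℝ | |θ| ≤ α}) := by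
  refine ⟨deriv f 0 / ((1 - f α) * (1 - f α)), ?_⟩
  rintro _ ⟨θ, hθ, rfl⟩
  obtain ⟨hαθ, hθα⟩ := abs_le.1 (show |θ| ≤ α from hθ)
  have hα : 0 < 1 - f α := sub_pos.2 (hf.lt_one α)
  have hleft : 1 - f α ≤ f θ := hf.symm α ▸ hf.strictMono.monotone hαθ
  have hright : 1 - f α ≤ 1 - f θ := sub_le_sub_left (hf.strictMono.monotone hθα) 1
  exact div_le_div₀ hf.deriv_zero_pos.le (hf.deriv_le_deriv_zero θ) (mul_pos hα hα)
    (mul_le_mul hleft hright hα.le (hf.pos θ).le)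

lemma le_steepness (hf : IsUnimodalLink f) {θ : ℝ} (hθ : |θ| ≤ α) :
    deriv f θ / (f θ * (1 - f θ)) ≤ steepness f α :=
  le_csSup (hf.bddAbove_steepness α) ⟨θ, hθ, rfl⟩

lemma steepness_pos (hf : IsUnimodalLink f) (hα : 0 ≤ α) : 0 < steepness f α :=
  (div_pos hf.deriv_zero_pos (mul_pos (hf.pos 0) (sub_pos.2 (hf.lt_one 0)))).trans_le
    (hf.le_steepness (by rwa [abs_zero]))

lemma hasDerivAt_log (hf : IsUnimodalLink f) (θ : ℝ) :
    HasDerivAt (fun x => Real.log (f x)) (deriv f θ / f θ) θ :=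
  (hf.differentiable θ).hasDerivAt.log (hf.pos θ).ne'

lemma hasDerivAt_deriv_div (hf : IsUnimodalLink f) {θ : ℝ} (hθ : θ ≠ 0) :
    HasDerivAt (fun x => deriv f x / f x)
      (-(deriv f θ ^ 2 / f θ ^ 2 - deriv (deriv f) θ / f θ)) θ := by
  have hne := (hf.pos θ).ne'
  refine ((hf.differentiableAt_deriv θ hθ).hasDerivAt.div (hf.differentiable θ).hasDerivAt
    hne).congr_deriv ?_
  field_simp
  ring

lemma strongConcaveOn_log (hf : IsUnimodalLink f) (hα : 0 ≤ α) (hγ : 0 < convexity f α) :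
    StrongConcaveOn (Set.Icc (-α) α) (convexity f α) fun x => Real.log (f x) := by
  have hbdd : BddBelow ((fun θ => deriv f θ ^ 2 / f θ ^ 2 - deriv (deriv f) θ / f θ) ''
      {θ : ℝ | |θ| ≤ α ∧ θ ≠ 0}) := by
    -- The infimum of a set that is not bounded below is `0` by convention.
    by_contra hunbdd
    exact hγ.ne' (Real.sInf_of_not_bddBelow hunbdd)
  refine strongConcaveOn_Icc_of_hasDerivAt2_le_of_ne ⟨neg_nonpos.2 hα, hα⟩
    (fun x _ => hf.hasDerivAt_log x) (fun x _ hx => hf.hasDerivAt_deriv_div hx) fun x hx hx0 => ?_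
  exact neg_le_neg (csInf_le hbdd ⟨x, ⟨abs_le.2 hx, hx0⟩, rfl⟩)

lemma log_le_quadratic (hf : IsUnimodalLink f) (hγ : 0 < convexity f α) {a b : ℝ}
    (ha : |a| ≤ α) (hb : |b| ≤ α) :
    Real.log (f b) ≤ Real.log (f a) + deriv f a / f a * (b - a) -
      convexity f α / 2 * (b - a) ^ 2 :=
  strongConcaveOn_le_quadratic (hf.strongConcaveOn_log ((abs_nonneg a).trans ha) hγ)
    (abs_le.1 ha) (abs_le.1 hb) (hf.hasDerivAt_log a)

lemma log_one_sub_le_quadratic (hf : IsUnimodalLink f) (hγ : 0 < convexity f α) {a b : ℝ}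
    (ha : |a| ≤ α) (hb : |b| ≤ α) :
    Real.log (1 - f b) ≤ Real.log (1 - f a) + -(deriv f a / (1 - f a)) * (b - a) -
      convexity f α / 2 * (b - a) ^ 2 := by
  have h := hf.log_le_quadratic hγ (a := -a) (b := -b) (by rwa [abs_neg]) (by rwa [abs_neg])
  rw [hf.symm, hf.symm, hf.deriv_neg] at h
  linarith

end IsUnimodalLink

section Likelihood

variable {K : ℕ} {d : Fin K → ℕ} {f : ℝ → ℝ} {α : ℝ} {D : Set (Tensor d)}
  {Θ Θ' Θtrue : Tensor d}

/-- The score of a single observation, that is, the derivative at `θ` of its log-likelihood. -/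
noncomputable def score (f : ℝ → ℝ) (θ : ℝ) (y : Fin 2) : ℝ :=
  if y = 1 then deriv f θ / f θ else -(deriv f θ / (1 - f θ))

/-- The score tensor, that is, the gradient at `Θ` of the log-likelihood of `y`. -/
noncomputable def scoreTensor (f : ℝ → ℝ) (Θ : Tensor d) (y : BinTensor d) : Tensor d :=
  fun i => score f (Θ i) (y i)

lemma logLik_le_quadratic (hf : IsUnimodalLink f) (hγ : 0 < convexity f α)
    (hΘ : ∀ i, |Θ i| ≤ α) (hΘ' : ∀ i, |Θ' i| ≤ α) (y : BinTensor d) :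
    logLik f y Θ' ≤ logLik f y Θ + scoreTensor f Θ y ⬝ᵥ (Θ' - Θ) -
      convexity f α / 2 * frobNorm (Θ' - Θ) ^ 2 := by
  simp only [logLik, dotProduct, frobNorm_sq, Finset.mul_sum, ← Finset.sum_add_distrib,
    ← Finset.sum_sub_distrib, ← sq, Pi.sub_apply]
  refine Finset.sum_le_sum fun i _ => ?_
  rcases (show y i = 0 ∨ y i = 1 by omega) with h | h
  · simpa [scoreTensor, score, h] using hf.log_one_sub_le_quadratic hγ (hΘ i) (hΘ' i)
  · simpa [scoreTensor, score, h] using hf.log_le_quadratic hγ (hΘ i) (hΘ' i)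

lemma continuous_logLik (hf : Continuous f) (hpos : ∀ θ, 0 < f θ) (hlt : ∀ θ, f θ < 1)
    (y : BinTensor d) : Continuous (logLik f y) := by
  have hcomp (i : Index d) : Continuous fun Θ : Tensor d => f (Θ i) := hf.comp (continuous_apply i)
  refine continuous_finsetSum _ fun i _ => .add ?_ ?_
  · exact .if_const _ ((hcomp i).log fun Θ => (hpos _).ne') continuous_const
  · exact .if_const _ ((continuous_const.sub (hcomp i)).log fun Θ => (sub_pos.2 (hlt _)).ne')
      continuous_const

lemma exists_isMLE (hf : IsUnimodalLink f) (hD : IsCompact D) (hne : D.Nonempty)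
    (y : BinTensor d) : ∃ Θhat, IsMLE f D y Θhat :=
  hD.exists_isMaxOn hne
    (continuous_logLik hf.differentiable.continuous hf.pos hf.lt_one y).continuousOn

lemma IsMLE.inLevelSet {y : BinTensor d} (h : IsMLE f D y Θ) (hΘ : Θtrue ∈ D) :
    InLevelSet f D Θtrue y Θ :=
  ⟨h.1, h.2 Θtrue hΘ⟩

end Likelihood

section Concentration

open NNReal

variable {Ω : Type*} [MeasurableSpace Ω] {μ : Measure Ω} {c : ℝ≥0}

lemma hasSubgaussianMGF_of_le {X : Ω → ℝ} {c' : ℝ≥0} (h : HasSubgaussianMGF X c μ) (hc : c ≤ c') :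
    HasSubgaussianMGF X c' μ where
  integrable_exp_mul := h.integrable_exp_mul
  mgf_le t := (h.mgf_le t).trans (by gcongr)

lemma one_sub_measureReal_compl_le [IsProbabilityMeasure μ] (s : Set Ω) :
    1 - μ.real sᶜ ≤ μ.real s := by
  have h := measureReal_union_le (μ := μ) s sᶜ
  rw [Set.union_compl_self, probReal_univ] at h
  linarith

variable {K : ℕ} {d : Fin K → ℕ}

lemma hasSubgaussianMGF_dotProduct {ι : Type*} [Fintype ι] {Z : ι → Ω → ℝ}
    (hind : iIndepFun Z μ) (hZ : ∀ i, HasSubgaussianMGF (Z i) c μ) (w : ι → ℝ) :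
    HasSubgaussianMGF (fun ω => (fun i => Z i ω) ⬝ᵥ w) (‖toLp 2 w‖₊ ^ 2 * c) μ := by
  have hw : ‖toLp 2 w‖₊ ^ 2 * c = ∑ i, NNReal.mk (w i ^ 2) (sq_nonneg _) * c := by
    rw [← Finset.sum_mul]
    congr 1
    ext
    simp [EuclideanSpace.real_norm_sq_eq]
  have hsum := HasSubgaussianMGF.sum_of_iIndepFun (s := Finset.univ)
    (hind.comp (fun i x => w i * x) fun i => measurable_const_mul (w i))
    fun i _ => (hZ i).const_mul (w i)
  simp only [Function.comp_def, mul_comm (w _)] at hsum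
  rw [hw]
  exact hsum

lemma measureReal_not_isSpectralBound_le [IsProbabilityMeasure μ] {Z : Index d → Ω → ℝ}
    (hind : iIndepFun Z μ) (hZ : ∀ i, HasSubgaussianMGF (Z i) c μ) {t : ℝ} (ht : 0 ≤ t) :
    μ.real {ω | ¬ IsSpectralBound (fun i => Z i ω) t} ≤
      5 ^ (∑ k, d k) * Real.exp (-t ^ 2 / (2 * ((2 ^ K) ^ 2 * c))) := by
  choose s hcard hnorm hs using fun k => exists_isNorming (EuclideanSpace ℝ (Fin (d k)))
  have hsub : {ω | ¬ IsSpectralBound (fun i => Z i ω) t} ⊆ ⋃ v ∈ Fintype.piFinset s,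
      {ω | t ≤ (fun i => Z i ω) ⬝ᵥ outer fun k => ofLp (v k)} := by
    intro ω hω
    by_contra hcon
    refine hω (isSpectralBound_of_isNorming hs fun v hv => ?_)
    simp only [Set.mem_iUnion, not_exists] at hcon
    exact (not_le.1 (hcon v (Fintype.mem_piFinset.2 hv))).le
  have htail (v) (hv : v ∈ Fintype.piFinset s) :
      μ.real {ω | t ≤ (fun i => Z i ω) ⬝ᵥ outer fun k => ofLp (v k)} ≤
        Real.exp (-t ^ 2 / (2 * ((2 ^ K) ^ 2 * c))) := by
    have hw : ‖toLp 2 (outer fun k => ofLp (v k))‖₊ ^ 2 ≤ (2 ^ K) ^ 2 := by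
      refine pow_le_pow_left' ?_ 2
      rw [← NNReal.coe_le_coe, coe_nnnorm, ← frobNorm_eq_norm]
      exact frobNorm_outer_le_pow fun k => hnorm k _ (Fintype.mem_piFinset.1 hv k)
    exact_mod_cast (hasSubgaussianMGF_of_le (hasSubgaussianMGF_dotProduct hind hZ _)
      (mul_le_mul_left hw c)).measure_ge_le ht
  calc _ ≤ ∑ v ∈ Fintype.piFinset s, _ :=
        (measureReal_mono hsub (measure_ne_top _ _)).trans (measureReal_biUnion_finset_le _ _)
    _ ≤ (Fintype.piFinset s).card • Real.exp (-t ^ 2 / (2 * ((2 ^ K) ^ 2 * c))) :=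
        Finset.sum_le_card_nsmul _ _ _ htail
    _ ≤ _ := by
        rw [nsmul_eq_mul, Fintype.card_piFinset, ← Finset.prod_pow_eq_pow_sum]
        gcongr
        push_cast
        refine Finset.prod_le_prod (fun k _ => by positivity) fun k _ => ?_
        exact_mod_cast (hcard k).trans_eq (by simp)

variable [IsProbabilityMeasure μ] {f : ℝ → ℝ} {Θ : Tensor d} {Y : Ω → BinTensor d} {α : ℝ}

lemma integral_score (hf : IsUnimodalLink f) (hY : IsBernoulliModel f Θ μ Y) (i : Index d) :
    ∫ ω, score f (Θ i) (Y ω i) ∂μ = 0 := by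
  have hmeas : MeasurableSet {ω | Y ω i = 1} := hY.measurable i (measurableSet_singleton 1)
  have hprob : μ.real {ω | Y ω i = 1} = f (Θ i) := by
    rw [measureReal_def, hY.prob, ENNReal.toReal_ofReal (hf.pos _).le]
  have hscore (ω) : score f (Θ i) (Y ω i) = {ω | Y ω i = 1}.indicator
      (fun _ => deriv f (Θ i) / f (Θ i) + deriv f (Θ i) / (1 - f (Θ i))) ω -
        deriv f (Θ i) / (1 - f (Θ i)) := by
    by_cases hω : Y ω i = 1 <;> simp [score, hω]
  simp only [hscore]
  rw [integral_sub ((integrable_const _).indicator hmeas) (integrable_const _),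
    integral_indicator_const _ hmeas, hprob, integral_const, probReal_univ, one_smul, smul_eq_mul]
  have hpos := (hf.pos (Θ i)).ne'
  have hlt := (sub_pos.2 (hf.lt_one (Θ i))).ne'
  field_simp
  ring

lemma hasSubgaussianMGF_score (hf : IsUnimodalLink f) (hY : IsBernoulliModel f Θ μ Y)
    (i : Index d) (hΘ : |Θ i| ≤ α) :
    HasSubgaussianMGF (fun ω => score f (Θ i) (Y ω i)) ((‖steepness f α‖₊ / 2) ^ 2) μ := by
  have hpos := hf.pos (Θ i)
  have hlt := sub_pos.2 (hf.lt_one (Θ i))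
  have hp : 0 ≤ deriv f (Θ i) / f (Θ i) := div_nonneg (hf.deriv_nonneg _) hpos.le
  have hq : 0 ≤ deriv f (Θ i) / (1 - f (Θ i)) := div_nonneg (hf.deriv_nonneg _) hlt.le
  have hrange : deriv f (Θ i) / f (Θ i) + deriv f (Θ i) / (1 - f (Θ i)) ≤ steepness f α := by
    refine le_of_eq_of_le ?_ (hf.le_steepness hΘ)
    field_simp
    ring
  have hmeas : Measurable fun ω => score f (Θ i) (Y ω i) :=
    (measurable_of_countable (score f (Θ i))).comp (hY.measurable i)
  have hmem (ω) : score f (Θ i) (Y ω i) ∈ Set.Icc (-(deriv f (Θ i) / (1 - f (Θ i))))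
      (-(deriv f (Θ i) / (1 - f (Θ i))) + steepness f α) := by
    unfold score
    split_ifs <;> constructor <;> linarith
  simpa only [add_sub_cancel_left] using hasSubgaussianMGF_of_mem_Icc_of_integral_eq_zero
    hmeas.aemeasurable (ae_of_all μ hmem) (integral_score hf hY i)

lemma one_sub_exp_le_measureReal_isSpectralBound_scoreTensor (hf : IsUnimodalLink f)
    (hY : IsBernoulliModel f Θ μ Y) (hΘ : ∀ i, |Θ i| ≤ α) (hα : 0 ≤ α) (hK : 1 ≤ K) :
    1 - Real.exp (-1 * Real.log K * ∑ k, (d k : ℝ)) ≤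
      μ.real {ω | IsSpectralBound (scoreTensor f Θ (Y ω))
        (2 ^ K * steepness f α * √(2 * K * ∑ k, (d k : ℝ)))} := by
  have hL := hf.steepness_pos hα
  have hK1 : (1 : ℝ) ≤ K := by exact_mod_cast hK
  set T : ℝ := ∑ k, (d k : ℝ) with hT
  have : 0 ≤ T := Finset.sum_nonneg fun k _ => Nat.cast_nonneg _
  refine le_trans ?_ (one_sub_measureReal_compl_le _)
  refine sub_le_sub_left ((measureReal_not_isSpectralBound_le
    (hY.indep.comp (fun i => score f (Θ i)) fun i => measurable_of_countable _)
    (fun i => hasSubgaussianMGF_score hf hY i (hΘ i)) (by positivity)).trans ?_) 1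
  have hexponent : (2 ^ K * steepness f α * √(2 * K * T)) ^ 2 /
      (2 * ((2 ^ K) ^ 2 * ((‖steepness f α‖₊ / 2 : ℝ≥0) ^ 2 : ℝ≥0))) = 4 * K * T := by
    push_cast
    rw [mul_pow, mul_pow, Real.sq_sqrt (by positivity), Real.norm_of_nonneg hL.le]
    field_simp
    ring
  have hlog5 : Real.log 5 ≤ 5 - 1 := Real.log_le_sub_one_of_pos (by norm_num)
  have hlogK : Real.log K ≤ K - 1 := Real.log_le_sub_one_of_pos (by linarith)
  calc 5 ^ (∑ k, d k) * Real.exp (-_ / _)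
      = Real.exp (Real.log 5 * T) * Real.exp (-(4 * K * T)) := by
        rw [neg_div, hexponent, Real.exp_mul, Real.exp_log (by norm_num), hT, ← Nat.cast_sum,
          Real.rpow_natCast]
    _ = Real.exp ((Real.log 5 - 4 * K) * T) := by
        rw [← Real.exp_add]
        ring_nf
    _ ≤ Real.exp (-1 * Real.log K * T) := by
        gcongr
        linarith

end Concentration

section Error

variable {K : ℕ} {d : Fin K → ℕ} {Θ Θ' : Tensor d} {f : ℝ → ℝ} {R : ℕ} {α : ℝ}

/-- The tensors of CP rank at most `R` and maximum norm at most `α`, a relaxation of `paramSet`.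
The decomposition may have vanishing terms, so the rank bound is an inequality. -/
def lowRankSet (d : Fin K → ℕ) (R : ℕ) (α : ℝ) : Set (Tensor d) :=
  {Θ | (∃ a : Fin R → (k : Fin K) → Fin (d k) → ℝ, Θ = ∑ r, outer (a r)) ∧ maxNorm Θ ≤ α}

lemma paramSet_subset_lowRankSet (hR : R ≠ 0) : paramSet d R α ⊆ lowRankSet d R α := by
  rintro Θ ⟨rfl, hα⟩
  exact ⟨Nat.sInf_mem (Nat.nonempty_of_sInf_eq_succ (Nat.succ_pred hR).symm), hα⟩

lemma abs_le_of_mem_lowRankSet (hΘ : Θ ∈ lowRankSet d R α) (i : Index d) : |Θ i| ≤ α :=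
  (le_ciSup (f := fun i => |Θ i|) (Set.finite_range _).bddAbove i).trans hΘ.2

lemma sub_mem_span_outer (hΘ : Θ ∈ lowRankSet d R α) (hΘ' : Θ' ∈ lowRankSet d R α) :
    ∃ a : Fin R ⊕ Fin R → (k : Fin K) → Fin (d k) → ℝ,
      Θ' - Θ ∈ Submodule.span ℝ (Set.range fun r => outer (a r)) := by
  obtain ⟨⟨a, rfl⟩, -⟩ := hΘ
  obtain ⟨⟨a', rfl⟩, -⟩ := hΘ'
  exact ⟨Sum.elim a' a, Submodule.sub_mem _
    (Submodule.sum_mem _ fun r _ => Submodule.subset_span ⟨Sum.inl r, rfl⟩)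
    (Submodule.sum_mem _ fun r _ => Submodule.subset_span ⟨Sum.inr r, rfl⟩)⟩

lemma frobNorm_le_sqrt_prod_mul {T : Tensor d} {m : ℝ} (hm : 0 ≤ m) (hT : ∀ i, |T i| ≤ m) :
    frobNorm T ≤ √(∏ k, (d k : ℝ)) * m := by
  have hcard : (Fintype.card (Index d) : ℝ) = ∏ k, (d k : ℝ) := by simp [Index, Fintype.card_pi]
  have hsum : ∑ i, T i ^ 2 ≤ Fintype.card (Index d) • m ^ 2 :=
    Finset.sum_le_card_nsmul _ _ _ fun i _ => sq_le_sq' (abs_le.1 (hT i)).1 (abs_le.1 (hT i)).2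
  rw [nsmul_eq_mul, hcard] at hsum
  calc frobNorm T ≤ √((∏ k, (d k : ℝ)) * m ^ 2) := Real.sqrt_le_sqrt hsum
    _ = √(∏ k, (d k : ℝ)) * m := by rw [Real.sqrt_mul' _ (sq_nonneg m), Real.sqrt_sq hm]

lemma loss_le_two_mul (hα : 0 ≤ α) (hΘ : ∀ i, |Θ i| ≤ α) (hΘ' : ∀ i, |Θ' i| ≤ α) :
    loss Θ' Θ ≤ 2 * α := by
  rw [loss, one_div]
  refine inv_mul_le_of_le_mul₀ (Real.sqrt_nonneg _) (by positivity)
    (frobNorm_le_sqrt_prod_mul (by positivity) fun i => ?_)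
  calc |Θ' i - Θ i| ≤ |Θ' i| + |Θ i| := abs_sub _ _
    _ ≤ 2 * α := by linarith [hΘ i, hΘ' i]

lemma frobNorm_sub_le_of_isSpectralBound {n : ℕ} {d : Fin (n + 1) → ℕ} {Θ Θ' : Tensor d}
    (hf : IsUnimodalLink f) (hγ : 0 < convexity f α) (hΘ : Θ ∈ lowRankSet d R α)
    (hΘ' : Θ' ∈ lowRankSet d R α) {y : BinTensor d} (hy : logLik f y Θ ≤ logLik f y Θ') {M : ℝ}
    (hM : 0 ≤ M) (hS : IsSpectralBound (scoreTensor f Θ y) M) :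
    frobNorm (Θ' - Θ) ≤ 2 * (M * √((2 * R) ^ n)) / convexity f α := by
  obtain ⟨a, ha⟩ := sub_mem_span_outer hΘ hΘ'
  have hdual : scoreTensor f Θ y ⬝ᵥ (Θ' - Θ) ≤ M * √((2 * R) ^ n) * frobNorm (Θ' - Θ) := by
    simpa [two_mul] using hS.dotProduct_le hM ha
  have htaylor := logLik_le_quadratic hf hγ (abs_le_of_mem_lowRankSet hΘ)
    (abs_le_of_mem_lowRankSet hΘ') y
  rw [le_div_iff₀ hγ]
  rcases (frobNorm_nonneg (Θ' - Θ)).eq_or_lt with hzero | hpos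
  · rw [← hzero, zero_mul]
    positivity
  · refine le_of_mul_le_mul_right ?_ hpos
    nlinarith only [hy, hdual, htaylor]

lemma ofReal_loss_le_errorBound (hK : 1 ≤ K) (hd : ∀ k, 1 ≤ d k) (hR : 1 ≤ R) (hα : 0 ≤ α)
    (hL : 0 < steepness f α) {C : ℝ} (hC : 0 < C) (hΘ : ∀ i, |Θ i| ≤ α) (hΘ' : ∀ i, |Θ' i| ≤ α)
    (h : 0 < convexity f α → frobNorm (Θ' - Θ) ≤ C * steepness f α / convexity f α *
      √((R : ℝ) ^ (K - 1) * ∑ k, (d k : ℝ))) :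
    ENNReal.ofReal (loss Θ' Θ) ≤ errorBound d f R α C := by
  have hP : 0 < ∏ k, (d k : ℝ) := Finset.prod_pos fun k _ => by exact_mod_cast hd k
  have hsum : 0 < ∑ k, (d k : ℝ) :=
    Finset.sum_pos (fun k _ => by exact_mod_cast hd k) ⟨⟨0, hK⟩, Finset.mem_univ _⟩
  have : (0 : ℝ) < R := by exact_mod_cast hR
  refine le_min (ENNReal.ofReal_le_ofReal (loss_le_two_mul hα hΘ hΘ')) ?_
  rcases le_or_gt (convexity f α) 0 with hγ | hγ
  · rw [ENNReal.ofReal_of_nonpos hγ, ENNReal.div_zero (ENNReal.ofReal_pos.2 (by positivity)).ne',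
      ENNReal.top_mul (ENNReal.ofReal_pos.2 (Real.sqrt_pos.2 (by positivity))).ne']
    exact le_top
  · rw [← ENNReal.ofReal_div_of_pos hγ, ← ENNReal.ofReal_mul (by positivity)]
    refine ENNReal.ofReal_le_ofReal ?_
    rw [loss, one_div, Real.sqrt_div (by positivity), inv_mul_le_iff₀ (Real.sqrt_pos.2 hP)]
    calc _ ≤ _ := h hγ
      _ = _ := by field_simp

/-- The factor `C₂` in the error bound for tensors of order `K`. With probability at least
`1 - exp (-log K * ∑ d_k)` the spectral norm of the score is at most `2^K L_α √(2 K ∑ d_k)`; strong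
concavity contributes a factor `2`, and the rank `2 R` of a difference a factor `√((2 R)^(K-1))`. -/
noncomputable def rateConstant (K : ℕ) : ℝ := 2 ^ (K + 1) * √(K * 2 ^ K)

lemma rateConstant_pos (hK : 1 ≤ K) : 0 < rateConstant K := by
  have : (0 : ℝ) < K := by exact_mod_cast hK
  unfold rateConstant
  positivity

lemma InLevelSet.ofReal_loss_le_errorBound {D : Set (Tensor d)} {y : BinTensor d}
    (h : InLevelSet f D Θ y Θ') (hf : IsUnimodalLink f) (hK : 1 ≤ K) (hd : ∀ k, 1 ≤ d k)
    (hR : 1 ≤ R) (hα : 0 ≤ α) (hD : D ⊆ lowRankSet d R α) (hΘ : Θ ∈ D)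
    (hS : IsSpectralBound (scoreTensor f Θ y)
      (2 ^ K * steepness f α * √(2 * K * ∑ k, (d k : ℝ)))) :
    ENNReal.ofReal (loss Θ' Θ) ≤ errorBound d f R α (rateConstant K) := by
  have hL := hf.steepness_pos hα
  have hT : 0 ≤ ∑ k, (d k : ℝ) := Finset.sum_nonneg fun k _ => Nat.cast_nonneg _
  refine BinaryTensor.ofReal_loss_le_errorBound hK hd hR hα hL (rateConstant_pos hK)
    (abs_le_of_mem_lowRankSet (hD hΘ)) (abs_le_of_mem_lowRankSet (hD h.1)) fun hγ => ?_
  obtain ⟨n, rfl⟩ : ∃ n, K = n + 1 := ⟨K - 1, by lia⟩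
  refine (frobNorm_sub_le_of_isSpectralBound hf hγ (hD hΘ) (hD h.1) h.2 (by positivity)
    hS).trans_eq ?_
  set T : ℝ := ∑ k, (d k : ℝ)
  have hsqrt : √(2 * (n + 1 : ℕ) * T) * √((2 * R) ^ n) =
      √((n + 1 : ℕ) * 2 ^ (n + 1)) * √(R ^ n * T) := by
    rw [← Real.sqrt_mul (by positivity), ← Real.sqrt_mul (by positivity)]
    congr 1
    ring
  rw [rateConstant, Nat.add_sub_cancel, mul_assoc _ _ √((2 * R) ^ n), hsqrt]
  ring

end Error

end BinaryTensor

open BinaryTensor in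
theorem theorem1_general :
    ∃ C₁ : ℝ, 0 < C₁ ∧ ∀ K : ℕ, 1 ≤ K → ∃ C₂ : ℝ, 0 < C₂ ∧
      ∀ (d : Fin K → ℕ) (_ : ∀ k, 1 ≤ d k) (f : ℝ → ℝ) (_ : IsUnimodalLink f)
        (R : ℕ) (_ : 1 ≤ R) (α : ℝ) (_ : 0 < α)
        (D : Set (Tensor d)) (_ : D ⊆ lowRankSet d R α) (Θtrue : Tensor d) (_ : Θtrue ∈ D)
        (Ω : Type*) (_ : MeasurableSpace Ω) (μ : Measure Ω) (_ : IsProbabilityMeasure μ)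
        (Y : Ω → BinTensor d) (_ : IsBernoulliModel f Θtrue μ Y),
        (IsCompact D → ∀ y : BinTensor d, ∃ Θhat, IsMLE f D y Θhat) ∧
        1 - Real.exp (-C₁ * Real.log K * ∑ k, (d k : ℝ)) ≤
          μ.real {ω | ∀ Θhat, IsMLE f D (Y ω) Θhat →
            ENNReal.ofReal (loss Θhat Θtrue) ≤ errorBound d f R α C₂} ∧
        1 - Real.exp (-C₁ * Real.log K * ∑ k, (d k : ℝ)) ≤
          μ.real {ω | ∀ Θhat, InLevelSet f D Θtrue (Y ω) Θhat →
            ENNReal.ofReal (loss Θhat Θtrue) ≤ errorBound d f R α C₂} := by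
  refine ⟨1, one_pos, fun K hK => ⟨rateConstant K, rateConstant_pos hK, ?_⟩⟩
  intro d hd f hf R hR α hα D hD Θ hΘ Ω _ μ _ Y hY
  have hspec := one_sub_exp_le_measureReal_isSpectralBound_scoreTensor hf hY
    (abs_le_of_mem_lowRankSet (hD hΘ)) hα.le hK
  refine ⟨fun hDc => exists_isMLE hf hDc ⟨Θ, hΘ⟩,
    hspec.trans (measureReal_mono fun ω hS Θhat h => ?_),
    hspec.trans (measureReal_mono fun ω hS Θhat h => ?_)⟩
  · exact (h.inLevelSet hΘ).ofReal_loss_le_errorBound hf hK hd hR hα.le hD hΘ hS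
  · exact h.ofReal_loss_le_errorBound hf hK hd hR hα.le hD hΘ hS

theorem theorem1 :
    ∃ C₁ : ℝ, 0 < C₁ ∧ ∀ K : ℕ, 1 ≤ K → ∃ C₂ : ℝ, 0 < C₂ ∧
      ∀ (d : Fin K → ℕ) (_ : ∀ k, 1 ≤ d k) (f : ℝ → ℝ) (_ : BinaryTensor.IsLink f)
        (R : ℕ) (_ : 1 ≤ R) (α : ℝ) (_ : 0 < α)
        (D : Set (BinaryTensor.Tensor d)) (_ : D ⊆ BinaryTensor.paramSet d R α)
        (_ : IsCompact D) (Θtrue : BinaryTensor.Tensor d) (_ : Θtrue ∈ D)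
        (Ω : Type*) (_ : MeasurableSpace Ω) (μ : Measure Ω) (_ : IsProbabilityMeasure μ)
        (Y : Ω → BinaryTensor.BinTensor d) (_ : BinaryTensor.IsBernoulliModel f Θtrue μ Y),
        -- a constrained maximum likelihood estimate exists for every observation
        (∀ y : BinaryTensor.BinTensor d, ∃ Θhat, BinaryTensor.IsMLE f D y Θhat) ∧
        -- the bound for the constrained maximum likelihood estimate
        1 - Real.exp (-C₁ * Real.log K * ∑ k, (d k : ℝ)) ≤
          μ.real {ω | ∀ Θhat, BinaryTensor.IsMLE f D (Y ω) Θhat →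
            ENNReal.ofReal (BinaryTensor.loss Θhat Θtrue) ≤
              BinaryTensor.errorBound d f R α C₂} ∧
        -- the same bound for every estimate in the level set
        1 - Real.exp (-C₁ * Real.log K * ∑ k, (d k : ℝ)) ≤
          μ.real {ω | ∀ Θhat, BinaryTensor.InLevelSet f D Θtrue (Y ω) Θhat →
            ENNReal.ofReal (BinaryTensor.loss Θhat Θtrue) ≤
              BinaryTensor.errorBound d f R α C₂} := by
  obtain ⟨C₁, hC₁, h⟩ := theorem1_general
  refine ⟨C₁, hC₁, fun K hK => (h K hK).imp fun C₂ hC₂ => ⟨hC₂.1, ?_⟩⟩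
  intro d hd f hf R hR α hα D hD hDc Θ hΘ Ω _ μ hμ Y hY
  exact (hC₂.2 d hd f hf.isUnimodalLink R hR α hα D
    (hD.trans (BinaryTensor.paramSet_subset_lowRankSet (by lia))) Θ hΘ Ω _ μ hμ Y hY).imp_left
    (· hDc)
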